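/- **Theorem 2.** Fix $N\ge 0$, let $k\in\{0,1,\dots,N\}$ be the time and $l\in\{0,1,2,\dots\}$ the iteration, and let $\|\cdot\|$ be any norms on the spaces of real vectors and matrices. Consider the uncertain system $$x_l(k+1)=A_l(k)x_l(k)+B_l(k)u_l(k)+w_l(k),\qquad y_l(k)=C_l(k)x_l(k)+D_l(k)u_l(k)+v_l(k)$$ with $x_l(k)\in\mathbb R^n$, $u_l(k)\in\mathbb R^m$, $y_l(k)\in\mathbb R^p$, references $r_l(k)\in\mathbb R^p$, tracking error $e_l(k)=r_l(k)-y_l(k)$, and updating law $$u_{l+1}(k)=u_l(k)+\Xi(k)e_l(k)$$ starting from a given initial input $u_0(k)$. Each of $A_l(k),B_l(k),C_l(k),D_l(k),w_l(k),v_l(k),r_l(k)$ and $x_l(0)$ is the sum of an iteration-independent nominal quantity $A(k),B(k),C(k),D(k),w(k),v(k),r(k),x_0$ and an uncertainty $\delta_A(l,k),\dots,\delta_r(l,k),\delta_{x_0}(l)$, where for all $l,k$ $$\|\delta_A(l,k)\|\le\overline\beta_A,\ \|\delta_B(l,k)\|\le\overline\beta_B,\ \dots,\ \|\delta_r(l,k)\|\le\overline\beta_r,\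 \|\delta_{x_0}(l)\|\le\overline\beta_{x_0}$$ with finite bounds $\overline\beta_A,\dots,\overline\beta_{x_0}\ge0$. Suppose that $\delta_D(l,k)=E(k)\Sigma_l(k)F(k)$ with fixed matrices $E(k),F(k)$ and matrices $\Sigma_l(k)$ satisfying $\Sigma_l(k)^{T}\Sigma_l(k)\le I$, and that for some scalar $\lambda>0$ the symmetric matrix $$\begin{bmatrix}-I&\star&\star&\star\\ I-D(k)\Xi(k)&-I&\star&\star\\ 0&\lambda E(k)^{T}&-\lambda I&\star\\ F(k)\Xi(k)&0&0&-\lambda I\end{bmatrix}$$ (where $\star$ denotes the terms induced by symmetry) is negative definite for every $k\in\{0,\dots,N\}$. Then: 1. $x_l(k),u_l(k),y_l(k)$ are uniformly bounded: there are finite $\beta_x,\beta_u,\beta_y\ge 0$ with $\sup_{l\ge0}\max_{0\le k\le N}\|x_l(k)\|\le\beta_x$, $\sup_{l\ge0}\max_{0\le k\le N}\|u_l(k)\|\le\beta_u$, $\sup_{l\ge0}\max_{0\le k\le N}\|y_l(k)\|\le\beta_y$. 2. $e_l(k)$ is uniformly bounded, and $$\limsup_{l\to\infty}\max_{0\le k\le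 N}\|e_l(k)\|\le\varepsilon,$$ where $\varepsilon=\varepsilon(\overline\beta_A,\overline\beta_B,\overline\beta_C,\overline\beta_D,\overline\beta_w,\overline\beta_v,\overline\beta_r,\overline\beta_{x_0})\ge0$ is a finite bound that, for the fixed nominal quantities $A(k),\dots,r(k),x_0$, gains $\Xi(k)$, matrices $E(k),F(k)$ and initial input $u_0(k)$, is a continuous function of the eight uncertainty bounds with $\varepsilon(0,\dots,0)=0$; in particular $\varepsilon\to0$ as all these bounds tend to $0$. The bounds $\beta_x,\beta_u,\beta_y$, and the bound for $e_l(k)$, depend on the uncertainties only through $\overline\beta_A,\dots,\overline\beta_{x_0}$. -/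

import Mathlib

open Filter
open scoped NNReal Matrix

/-- A choice of a norm on every space of real matrices. -/
structure MatrixNorms where
  norm : ∀ a b : ℕ, Seminorm ℝ (Matrix (Fin a) (Fin b) ℝ)
  definite : ∀ (a b : ℕ) (M : Matrix (Fin a) (Fin b) ℝ), norm a b M = 0 → M = 0

/-- The norm of a matrix. -/
def MatrixNorms.mat (ν : MatrixNorms) {a b : ℕ} (M : Matrix (Fin a) (Fin b) ℝ) : ℝ :=
  ν.norm a b M

/-- The norm of a vector, regarded as a matrix with one column. -/
def MatrixNorms.vec (ν : MatrixNorms) {a : ℕ} (z : Fin a → ℝ) : ℝ :=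
  ν.norm a 1 (Matrix.replicateCol (Fin 1) z)

/-- The quantities that determine the tracking task in one iteration: system matrices, load and
measurement disturbances, reference trajectory (all of them functions of the time `k`) and initial
state. The same type holds the nominal quantities, and the uncertainties of one iteration. Only the
times `0, …, N` matter. -/
structure ILCData (n m p : ℕ) where
  A : ℕ → Matrix (Fin n) (Fin n) ℝ
  B : ℕ → Matrix (Fin n) (Fin m) ℝ
  C : ℕ → Matrix (Fin p) (Fin n) ℝ
  D : ℕ → Matrix (Fin p) (Fin m) ℝ
  w : ℕ → Fin n → ℝ
  v : ℕ → Fin p → ℝ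
  r : ℕ → Fin p → ℝ
  x₀ : Fin n → ℝ

/-- Nominal quantities plus additive uncertainties. -/
def ILCData.perturb {n m p : ℕ} (P δ : ILCData n m p) : ILCData n m p where
  A k := P.A k + δ.A k
  B k := P.B k + δ.B k
  C k := P.C k + δ.C k
  D k := P.D k + δ.D k
  w k := P.w k + δ.w k
  v k := P.v k + δ.v k
  r k := P.r k + δ.r k
  x₀ := P.x₀ + δ.x₀

/-- The eight classes of uncertainties. -/
inductive UncertaintyClass
  | A | B | C | D | w | v | r | x₀

/-- All uncertainties, over all iterations `l` and all times `0 ≤ k ≤ N`, obey the bounds `β`. -/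
structure BoundedUncertainties {n m p : ℕ} (N : ℕ) (ν : MatrixNorms)
    (β : UncertaintyClass → ℝ≥0) (δ : ℕ → ILCData n m p) : Prop where
  A : ∀ l k, k ≤ N → ν.mat ((δ l).A k) ≤ β .A
  B : ∀ l k, k ≤ N → ν.mat ((δ l).B k) ≤ β .B
  C : ∀ l k, k ≤ N → ν.mat ((δ l).C k) ≤ β .C
  D : ∀ l k, k ≤ N → ν.mat ((δ l).D k) ≤ β .D
  w : ∀ l k, k ≤ N → ν.vec ((δ l).w k) ≤ β .w
  v : ∀ l k, k ≤ N → ν.vec ((δ l).v k) ≤ β .v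
  r : ∀ l k, k ≤ N → ν.vec ((δ l).r k) ≤ β .r
  x₀ : ∀ l, ν.vec ((δ l).x₀) ≤ β .x₀

/-- The uncertainty of the feedthrough matrix is `E(k) S_l(k) F(k)` with `S_l(k)ᵀ S_l(k) ≤ I`. -/
def StructuredFeedthrough {n m p a b : ℕ} (N : ℕ) (E : ℕ → Matrix (Fin p) (Fin a) ℝ)
    (F : ℕ → Matrix (Fin b) (Fin m) ℝ) (δ : ℕ → ILCData n m p) : Prop :=
  ∃ S : ℕ → ℕ → Matrix (Fin a) (Fin b) ℝ, ∀ l k, k ≤ N →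
    (δ l).D k = E k * S l k * F k ∧ (1 - (S l k)ᵀ * S l k).PosSemidef

/-- `x, u, y, e` are the state, input, output and tracking error of the system with the data `T l`
in iteration `l`, where the input is updated from iteration to iteration with the gains `Ξ`, `Γ`. -/
structure IsILCProcess {n m p : ℕ} (N : ℕ) (T : ℕ → ILCData n m p)
    (Ξ Γ : ℕ → Matrix (Fin m) (Fin p) ℝ) (x : ℕ → ℕ → Fin n → ℝ) (u : ℕ → ℕ → Fin m → ℝ)
    (y e : ℕ → ℕ → Fin p → ℝ) : Prop where
  init : ∀ l, x l 0 = (T l).x₀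
  state : ∀ l k, k ≤ N → x l (k + 1) = (T l).A k *ᵥ x l k + (T l).B k *ᵥ u l k + (T l).w k
  output : ∀ l k, k ≤ N → y l k = (T l).C k *ᵥ x l k + (T l).D k *ᵥ u l k + (T l).v k
  error : ∀ l k, k ≤ N → e l k = (T l).r k - y l k
  update : ∀ l k, k ≤ N → u (l + 1) k = u l k + Ξ k *ᵥ e l k + Γ k *ᵥ e l (k + 1)

/-- The symmetric block matrix
`[-I, *, *, *; I - D Ξ, -I, *, *; 0, lam Eᵀ, -lam I, *; F Ξ, 0, 0, -lam I]`. -/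
def lmiMatrix {m p a b : ℕ} (D : Matrix (Fin p) (Fin m) ℝ) (Ξ : Matrix (Fin m) (Fin p) ℝ)
    (E : Matrix (Fin p) (Fin a) ℝ) (F : Matrix (Fin b) (Fin m) ℝ) (lam : ℝ) :
    Matrix ((Fin p ⊕ Fin p) ⊕ (Fin a ⊕ Fin b)) ((Fin p ⊕ Fin p) ⊕ (Fin a ⊕ Fin b)) ℝ :=
  Matrix.fromBlocks
    (Matrix.fromBlocks (-1) (1 - D * Ξ)ᵀ (1 - D * Ξ) (-1))
    (Matrix.fromBlocks 0 (lam • Eᵀ) (F * Ξ) 0)ᵀ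
    (Matrix.fromBlocks 0 (lam • Eᵀ) (F * Ξ) 0)
    (Matrix.fromBlocks (-(lam • 1)) 0 0 (-(lam • 1)))

/-- Negative definiteness of a symmetric real matrix. -/
def NegDefinite {ι : Type} [Fintype ι] (M : Matrix ι ι ℝ) : Prop :=
  (-M).PosDef

/-- The maximum of `f k` over `0 ≤ k ≤ N`. -/
def maxOverTime (N : ℕ) (f : ℕ → ℝ) : ℝ :=
  (Finset.range (N + 1)).sup' Finset.nonempty_range_add_one f

/-! The linear matrix inequality, tested on one well-chosen vector, gives `ρ < 1` with `|z - D_l Ξ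
z| ≤ ρ |z|` in the Euclidean norm for every admissible feedthrough matrix `D_l = D + E S F`
(`NegDefinite.exists_contraction`). This contraction is used twice.

Boundedness: `u_l = u_0 + Ξ η_l`, where `η_l` is the sum of the past errors, and `η_{l+1} = (η_l -
D_l Ξ η_l) + (r_l - C_l x_l - v_l - D_l u_0)`. A bound for the state at time `k` therefore bounds
the input at time `k`, and the state equation carries the bound to time `k + 1`.

Convergence: `e_{l+1} = (e_l - D_{l+1} Ξ e_l)` plus a forcing term made of `C (x_{l+1} - x_l)` and
differences of uncertainties. The forcing is asymptotically small if the state hardly varies with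
`l`. In turn, the state variation at time `k + 1` is controlled by the variation and the error at
time `k`, since `u_{l+1} - u_l = Ξ e_l`. Induction on time starts from the initial states, which
vary by at most twice the uncertainty.

All constants are explicit polynomials in one scalar bound `s` for the uncertainties, and the error
bound vanishes at `s = 0`. Equivalence of norms transfers the result to arbitrary norms. -/

section

open scoped Matrix.Norms.L2Operator

/-! ### Equivalence of norms and the Euclidean norm -/

/-- On a finite-dimensional space every seminorm is dominated by every norm. -/
theorem Seminorm.exists_le_mul_of_definite {V : Type*} [AddCommGroup V] [Module ℝ V]
    [FiniteDimensional ℝ V] (p q : Seminorm ℝ V) (hq : ∀ x, q x = 0 → x = 0) :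
    ∃ c : ℝ, 0 < c ∧ ∀ x, p x ≤ c * q x := by
  let _ : NormedAddCommGroup V :=
    AddGroupNorm.toNormedAddCommGroup
      { q.toAddGroupSeminorm with eq_zero_of_map_eq_zero' := hq }
  let _ : NormedSpace ℝ V := { norm_smul_le := fun a x => (map_smul_eq_mul q a x).le }
  -- A seminorm is convex, and convex functions on a finite-dimensional space are continuous, here
  -- for the topology of `q`.
  have hp : Continuous p := by
    rw [← continuousOn_univ]
    exact p.convexOn.continuousOn isOpen_univ
  obtain ⟨c, hc, h⟩ := Seminorm.bound_of_continuous_normedSpace p hp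
  exact ⟨c, hc, h⟩

/-- The Euclidean norm of a real vector. -/
noncomputable def euclNorm {a : ℕ} (z : Fin a → ℝ) : ℝ :=
  ‖(WithLp.toLp 2 z : EuclideanSpace ℝ (Fin a))‖

section EuclNorm

variable {a b : ℕ}

theorem euclNorm_nonneg (z : Fin a → ℝ) : 0 ≤ euclNorm z := norm_nonneg _

@[simp] theorem euclNorm_zero : euclNorm (0 : Fin a → ℝ) = 0 := by simp [euclNorm]

theorem euclNorm_add_le (z z' : Fin a → ℝ) : euclNorm (z + z') ≤ euclNorm z + euclNorm z' := by
  simpa [euclNorm] using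
    norm_add_le (WithLp.toLp 2 z : EuclideanSpace ℝ (Fin a)) (WithLp.toLp 2 z')

theorem euclNorm_sub_le (z z' : Fin a → ℝ) : euclNorm (z - z') ≤ euclNorm z + euclNorm z' := by
  simpa [euclNorm] using
    norm_sub_le (WithLp.toLp 2 z : EuclideanSpace ℝ (Fin a)) (WithLp.toLp 2 z')

theorem euclNorm_mulVec_le (M : Matrix (Fin a) (Fin b) ℝ) (z : Fin b → ℝ) :
    euclNorm (M *ᵥ z) ≤ ‖M‖ * euclNorm z :=
  Matrix.l2_opNorm_mulVec M (WithLp.toLp 2 z)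

theorem euclNorm_mulVec_le_of_le {M : Matrix (Fin a) (Fin b) ℝ} {z : Fin b → ℝ} {c d : ℝ}
    (hM : ‖M‖ ≤ c) (hz : euclNorm z ≤ d) : euclNorm (M *ᵥ z) ≤ c * d :=
  (euclNorm_mulVec_le M z).trans
    (mul_le_mul hM hz (euclNorm_nonneg _) ((norm_nonneg _).trans hM))

theorem euclNorm_sq (z : Fin a → ℝ) : euclNorm z ^ 2 = z ⬝ᵥ z := by
  simp only [euclNorm, EuclideanSpace.norm_sq_eq, Real.norm_eq_abs, sq_abs, dotProduct]
  simp only [sq]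

end EuclNorm

namespace MatrixNorms

variable (ν : MatrixNorms)

theorem vec_nonneg {a : ℕ} (z : Fin a → ℝ) : 0 ≤ ν.vec z :=
  apply_nonneg (ν.norm a 1) _

/-- Matrices enter only as bounded data, so this direction suffices for them; vectors need both
directions. -/
theorem exists_l2_opNorm_le (a b : ℕ) :
    ∃ c : ℝ, 0 < c ∧ ∀ M : Matrix (Fin a) (Fin b) ℝ, ‖M‖ ≤ c * ν.mat M :=
  Seminorm.exists_le_mul_of_definite (normSeminorm ℝ (Matrix (Fin a) (Fin b) ℝ)) (ν.norm a b)
    (ν.definite a b)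

theorem exists_euclNorm_le (a : ℕ) :
    ∃ c : ℝ, 0 < c ∧ ∀ z : Fin a → ℝ, euclNorm z ≤ c * ν.vec z := by
  let f : Matrix (Fin a) (Fin 1) ℝ →ₗ[ℝ] EuclideanSpace ℝ (Fin a) :=
    { toFun := fun M => WithLp.toLp 2 (fun i => M i 0)
      map_add' := fun _ _ => rfl
      map_smul' := fun _ _ => rfl }
  obtain ⟨c, hc, h⟩ := Seminorm.exists_le_mul_of_definite
    ((normSeminorm ℝ (EuclideanSpace ℝ (Fin a))).comp f) (ν.norm a 1) (ν.definite a 1)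
  exact ⟨c, hc, fun z => h (Matrix.replicateCol (Fin 1) z)⟩

theorem exists_vec_le (a : ℕ) :
    ∃ c : ℝ, 0 < c ∧ ∀ z : Fin a → ℝ, ν.vec z ≤ c * euclNorm z := by
  let f : EuclideanSpace ℝ (Fin a) →ₗ[ℝ] Matrix (Fin a) (Fin 1) ℝ :=
    { toFun := fun z => Matrix.replicateCol (Fin 1) (WithLp.ofLp z)
      map_add' := fun _ _ => rfl
      map_smul' := fun _ _ => rfl }
  obtain ⟨c, hc, h⟩ := Seminorm.exists_le_mul_of_definite
    ((ν.norm a 1).comp f) (normSeminorm ℝ (EuclideanSpace ℝ (Fin a)))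
    (fun x hx => norm_eq_zero.mp hx)
  exact ⟨c, hc, fun z => h (WithLp.toLp 2 z)⟩

end MatrixNorms

/-! ### From the matrix inequality to a contraction -/

/-- A positive definite matrix is bounded below by a positive multiple of the identity. -/
theorem Matrix.PosDef.exists_pos_mul_le {ι : Type*} [Fintype ι] {M : Matrix ι ι ℝ}
    (hM : M.PosDef) : ∃ μ : ℝ, 0 < μ ∧ ∀ z : ι → ℝ, μ * (z ⬝ᵥ z) ≤ z ⬝ᵥ (M *ᵥ z) := by
  have hcont : Continuous fun z : EuclideanSpace ℝ ι => z.ofLp ⬝ᵥ (M *ᵥ z.ofLp) := by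
    fun_prop
  -- Compactness gives a positive lower bound on the unit sphere, also when the sphere is empty;
  -- homogeneity extends it.
  obtain ⟨μ, hμ, h⟩ := (isCompact_sphere (0 : EuclideanSpace ℝ ι) 1).exists_forall_le'
    hcont.continuousOn (a := 0) (fun z hz => by
      have hz0 : z.ofLp ≠ 0 := by
        rintro h0
        have : z = 0 := by simpa using h0
        simp [this] at hz
      simpa using hM.dotProduct_mulVec_pos hz0)
  refine ⟨μ, hμ, fun z => ?_⟩
  by_cases hz : z = 0
  · simp [hz]
  set r : ℝ := ‖(WithLp.toLp 2 z : EuclideanSpace ℝ ι)‖ with hr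
  have hr0 : 0 < r := norm_pos_iff.mpr (by simpa using hz)
  have hr2 : z ⬝ᵥ z = r ^ 2 := by
    simp only [hr, EuclideanSpace.norm_sq_eq, Real.norm_eq_abs, sq_abs, dotProduct]
    simp only [sq]
  have hs := h (r⁻¹ • WithLp.toLp 2 z) (by
    rw [mem_sphere_zero_iff_norm, norm_smul, norm_inv, Real.norm_of_nonneg hr0.le, ← hr,
      inv_mul_cancel₀ hr0.ne'])
  simp only [WithLp.ofLp_smul, Matrix.mulVec_smul, dotProduct_smul, smul_dotProduct,
    smul_eq_mul] at hs
  rw [hr2]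
  calc μ * r ^ 2 ≤ r⁻¹ * (r⁻¹ * (z ⬝ᵥ M *ᵥ z)) * r ^ 2 := by gcongr
    _ = _ := by field_simp

/-- The quadratic form of the matrix of the linear matrix inequality. -/
theorem dotProduct_lmiMatrix_mulVec {m p a b : ℕ} (D : Matrix (Fin p) (Fin m) ℝ)
    (Ξ : Matrix (Fin m) (Fin p) ℝ) (E : Matrix (Fin p) (Fin a) ℝ) (F : Matrix (Fin b) (Fin m) ℝ)
    (lam : ℝ) (z₁ z₂ : Fin p → ℝ) (z₃ : Fin a → ℝ) (z₄ : Fin b → ℝ) :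
    Sum.elim (Sum.elim z₁ z₂) (Sum.elim z₃ z₄) ⬝ᵥ
      (lmiMatrix D Ξ E F lam *ᵥ Sum.elim (Sum.elim z₁ z₂) (Sum.elim z₃ z₄)) =
      -(z₁ ⬝ᵥ z₁) - z₂ ⬝ᵥ z₂ - lam * (z₃ ⬝ᵥ z₃) - lam * (z₄ ⬝ᵥ z₄)
        + 2 * (z₂ ⬝ᵥ ((1 - D * Ξ) *ᵥ z₁)) + 2 * lam * (z₃ ⬝ᵥ (Eᵀ *ᵥ z₂))
        + 2 * (z₄ ⬝ᵥ ((F * Ξ) *ᵥ z₁)) := by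
  have ht : ∀ {c d : ℕ} (M : Matrix (Fin c) (Fin d) ℝ) (s : Fin c → ℝ) (t : Fin d → ℝ),
      t ⬝ᵥ (Mᵀ *ᵥ s) = s ⬝ᵥ (M *ᵥ t) := by
    intro c d M s t
    rw [Matrix.mulVec_transpose, dotProduct_comm, Matrix.dotProduct_mulVec]
  rw [lmiMatrix, Matrix.fromBlocks_transpose]
  simp only [Matrix.fromBlocks_mulVec, Sum.elim_comp_inl, Sum.elim_comp_inr, Matrix.transpose_zero, Matrix.zero_mulVec,
    Matrix.neg_mulVec, Matrix.one_mulVec, Matrix.smul_mulVec, sumElim_dotProduct_sumElim,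
    dotProduct_add, dotProduct_neg, dotProduct_smul, smul_eq_mul, ht,
    Matrix.transpose_smul, Matrix.transpose_transpose, add_zero, zero_add]
  ring

/-- The linear matrix inequality makes the iteration of the tracking error a contraction, uniformly
over all admissible uncertainties of the feedthrough matrix. -/
theorem NegDefinite.exists_contraction {m p a b : ℕ} {D : Matrix (Fin p) (Fin m) ℝ}
    {Ξ : Matrix (Fin m) (Fin p) ℝ} {E : Matrix (Fin p) (Fin a) ℝ} {F : Matrix (Fin b) (Fin m) ℝ}
    {lam : ℝ} (hlam : 0 < lam) (h : NegDefinite (lmiMatrix D Ξ E F lam)) :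
    ∃ ρ : ℝ, 0 ≤ ρ ∧ ρ < 1 ∧ ∀ S : Matrix (Fin a) (Fin b) ℝ, (1 - Sᵀ * S).PosSemidef →
      ∀ z : Fin p → ℝ, euclNorm (z - (D + E * S * F) *ᵥ (Ξ *ᵥ z)) ≤ ρ * euclNorm z := by
  obtain ⟨μ, hμ, hμle⟩ := Matrix.PosDef.exists_pos_mul_le h
  refine ⟨√(1 / (1 + μ)), Real.sqrt_nonneg _, ?_, fun S hS z => ?_⟩
  · rw [Real.sqrt_lt' one_pos, one_pow, div_lt_one (by positivity)]
    linarith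
  set g : Fin p → ℝ := z - (D + E * S * F) *ᵥ (Ξ *ᵥ z) with hg
  set q : Fin b → ℝ := (F * Ξ) *ᵥ z with hq
  set t : Fin a → ℝ := Eᵀ *ᵥ g with ht
  -- With this test vector the form equals `-|z|² + |g|²` plus the expression in `hcross`. The last
  -- two blocks are tuned so that the uncertain term `2 t ⬝ᵥ S q` is absorbed by a square.
  have hz := hμle (Sum.elim (Sum.elim z g) (Sum.elim t (lam⁻¹ • q)))
  rw [Matrix.neg_mulVec, dotProduct_neg, dotProduct_lmiMatrix_mulVec] at hz
  simp only [sumElim_dotProduct_sumElim, dotProduct_smul, smul_dotProduct, smul_eq_mul,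
    ← hq, ← ht] at hz
  have hnom : (1 - D * Ξ) *ᵥ z = g + E *ᵥ (S *ᵥ q) := by
    simp only [hg, hq, Matrix.sub_mulVec, Matrix.add_mulVec, Matrix.mulVec_mulVec,
      Matrix.one_mulVec, Matrix.mul_assoc, Matrix.add_mul]
    abel
  have hgE : g ⬝ᵥ (E *ᵥ (S *ᵥ q)) = t ⬝ᵥ (S *ᵥ q) := by
    rw [ht, Matrix.mulVec_transpose, Matrix.dotProduct_mulVec]
  rw [hnom, dotProduct_add, hgE] at hz
  have hSq : (S *ᵥ q) ⬝ᵥ (S *ᵥ q) ≤ q ⬝ᵥ q := by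
    have := hS.dotProduct_mulVec_nonneg q
    rw [star_trivial, Matrix.sub_mulVec, Matrix.one_mulVec, dotProduct_sub,
      ← Matrix.mulVec_mulVec, Matrix.mulVec_transpose, dotProduct_comm q (Matrix.vecMul _ _),
      ← Matrix.dotProduct_mulVec] at this
    linarith
  have hnn : ∀ {c : ℕ} (w : Fin c → ℝ), 0 ≤ w ⬝ᵥ w := fun w => by
    rw [← euclNorm_sq]; positivity
  -- Completing the square: the expression is at least `lam⁻¹ |lam t + S q|²`, because `|S q| ≤
  -- |q|`.
  have hcross : 0 ≤ lam * (t ⬝ᵥ t) + 2 * (t ⬝ᵥ (S *ᵥ q)) + lam⁻¹ * (q ⬝ᵥ q) := by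
    have h1 := hnn (lam • t + S *ᵥ q)
    simp only [dotProduct_add, add_dotProduct, dotProduct_smul, smul_dotProduct, smul_eq_mul,
      dotProduct_comm (S *ᵥ q) t] at h1
    have h2 : 0 ≤ lam⁻¹ * (lam * (lam * (t ⬝ᵥ t)) + 2 * lam * (t ⬝ᵥ (S *ᵥ q)) + q ⬝ᵥ q) :=
      mul_nonneg (inv_nonneg.mpr hlam.le) (by linarith)
    have h3 : lam⁻¹ * (lam * (lam * (t ⬝ᵥ t)) + 2 * lam * (t ⬝ᵥ (S *ᵥ q)) + q ⬝ᵥ q) =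
        lam * (t ⬝ᵥ t) + 2 * (t ⬝ᵥ (S *ᵥ q)) + lam⁻¹ * (q ⬝ᵥ q) := by
      field_simp
    linarith
  have hcancel : lam * (lam⁻¹ * (lam⁻¹ * (q ⬝ᵥ q))) = lam⁻¹ * (q ⬝ᵥ q) := by
    field_simp
  have hkey : (1 + μ) * euclNorm g ^ 2 ≤ euclNorm z ^ 2 := by
    rw [euclNorm_sq, euclNorm_sq]
    have e1 := mul_nonneg hμ.le (hnn z)
    have e2 := mul_nonneg hμ.le (hnn t)
    have e3 := mul_nonneg hμ.le (hnn (lam⁻¹ • q))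
    simp only [dotProduct_smul, smul_dotProduct, smul_eq_mul] at e3
    linarith
  refine abs_le_of_sq_le_sq' ?_ (mul_nonneg (Real.sqrt_nonneg _) (euclNorm_nonneg z)) |>.2
  rw [mul_pow, Real.sq_sqrt (by positivity), one_div, inv_mul_eq_div,
    le_div_iff₀ (by positivity)]
  linarith

/-! ### Asymptotic upper bounds of real sequences -/

/-- The sequence `f` is eventually below every number larger than `c`. -/
def AsymptoticallyLE (f : ℕ → ℝ) (c : ℝ) : Prop :=
  ∀ η > 0, ∀ᶠ l in atTop, f l ≤ c + η

namespace AsymptoticallyLE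

variable {f g : ℕ → ℝ} {c d : ℝ}

theorem of_le (h : ∀ l, f l ≤ c) : AsymptoticallyLE f c := fun _ hη =>
  Eventually.of_forall fun l => (h l).trans (le_add_of_nonneg_right (le_of_lt hη))

theorem mono (hg : AsymptoticallyLE g c) (h : ∀ l, f l ≤ g l) : AsymptoticallyLE f c :=
  fun η hη => (hg η hη).mono fun l hl => (h l).trans hl

theorem add (hf : AsymptoticallyLE f c) (hg : AsymptoticallyLE g d) :
    AsymptoticallyLE (fun l => f l + g l) (c + d) := fun η hη => by
  filter_upwards [hf (η / 2) (half_pos hη), hg (η / 2) (half_pos hη)] with l h1 h2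
  linarith

theorem const_mul {a : ℝ} (ha : 0 ≤ a) (hf : AsymptoticallyLE f c) :
    AsymptoticallyLE (fun l => a * f l) (a * c) := fun η hη => by
  -- Dividing by `a + 1` covers `a = 0`.
  filter_upwards [hf (η / (a + 1)) (by positivity)] with l hl
  have h1 : a * (η / (a + 1)) ≤ η := by
    rw [mul_div_assoc', div_le_iff₀ (by positivity)]
    nlinarith
  nlinarith [mul_le_mul_of_nonneg_left hl ha]

/-- Once `g` is almost below `c`, the excess of `f` over the fixed point of the affine recursion
decays geometrically. -/
theorem of_contraction {ρ : ℝ} (hρ0 : 0 ≤ ρ) (hρ1 : ρ < 1) (hg : AsymptoticallyLE g c)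
    (h : ∀ l, f (l + 1) ≤ ρ * f l + g l) : AsymptoticallyLE f ((1 - ρ)⁻¹ * c) := by
  intro η hη
  have hpos : 0 < 1 - ρ := sub_pos.mpr hρ1
  -- This slack raises the fixed point by exactly `η / 2`; the other half absorbs the geometric
  -- term.
  obtain ⟨L, hL⟩ := eventually_atTop.mp (hg (η / 2 * (1 - ρ)) (by positivity))
  set c' : ℝ := (1 - ρ)⁻¹ * c + η / 2 with hc'
  have hfix : ρ * c' + (c + η / 2 * (1 - ρ)) = c' := by
    rw [hc']
    field_simp
    ring
  have hdecay : ∀ j, f (L + j) ≤ c' + ρ ^ j * |f L - c'| := by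
    intro j
    induction j with
    | zero => simpa using (by linarith [le_abs_self (f L - c')] : f L ≤ c' + |f L - c'|)
    | succ j ih =>
      have h1 := h (L + j)
      have h2 := hL (L + j) (Nat.le_add_right _ _)
      have h3 := mul_le_mul_of_nonneg_left ih hρ0
      rw [← add_assoc, pow_succ]
      linarith
  have hlim : Tendsto (fun j : ℕ => ρ ^ j * |f L - c'|) atTop (nhds 0) := by
    simpa using (tendsto_pow_atTop_nhds_zero_of_lt_one hρ0 hρ1).mul_const |f L - c'|
  obtain ⟨J, hJ⟩ := eventually_atTop.mp (hlim.eventually_le_const (half_pos hη))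
  refine eventually_atTop.mpr ⟨L + J, fun l hl => ?_⟩
  obtain ⟨j, rfl⟩ := Nat.exists_eq_add_of_le (by omega : L ≤ l)
  have := hdecay j
  have := hJ j (by omega)
  linarith

end AsymptoticallyLE

/-! ### Explicit bounds and their dependence on the uncertainty -/

/-- A bound for the input at one time, where `c` bounds all data and `X` bounds the state. -/
def inputBound (τ c X : ℝ) : ℝ :=
  c + c * (τ * (c + c * X + c + c * c))

/-- A bound for the state at the time `k`, where `c` bounds all data. -/
def stateBound (τ c : ℝ) : ℕ → ℝ
  | 0 => c
  | k + 1 => c * stateBound τ c k + c * inputBound τ c (stateBound τ c k) + c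

/-- An asymptotic bound for the tracking error at one time, where `c` bounds all data, `s` bounds
all uncertainties, `X` bounds the state and `V` its asymptotic variation between iterations. -/
def errorLimitBound (τ c s X V : ℝ) : ℝ :=
  τ * (4 * s + c * V + 2 * (s * X) + 2 * (s * inputBound τ c X))

/-- An asymptotic bound for the variation of the state between iterations at the time `k`. -/
def stateVariationBound (τ c s : ℝ) : ℕ → ℝ
  | 0 => 2 * s
  | k + 1 => c * stateVariationBound τ c s k
      + c * (c * errorLimitBound τ c s (stateBound τ c k) (stateVariationBound τ c s k))
      + (2 * (s * stateBound τ c k) + 2 * (s * inputBound τ c (stateBound τ c k)) + 2 * s)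

theorem continuous_stateBound (τ : ℝ) (k : ℕ) : Continuous fun c => stateBound τ c k := by
  induction k with
  | zero =>
    simp only [stateBound]
    fun_prop
  | succ k ih =>
    simp only [stateBound, inputBound]
    fun_prop

/-- The data bound is `κ + s`, nominal plus uncertain, so `s` enters through both arguments. -/
theorem continuous_stateVariationBound (τ κ : ℝ) (k : ℕ) :
    Continuous fun s => stateVariationBound τ (κ + s) s k := by
  induction k with
  | zero =>
    simp only [stateVariationBound]
    fun_prop
  | succ k ih =>
    have := (continuous_stateBound τ k).comp (continuous_const_add κ)
    simp only [Function.comp_def] at this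
    simp only [stateVariationBound, errorLimitBound, inputBound]
    fun_prop

theorem continuous_errorLimitBound (τ κ : ℝ) (k : ℕ) :
    Continuous fun s => errorLimitBound τ (κ + s) s (stateBound τ (κ + s) k)
      (stateVariationBound τ (κ + s) s k) := by
  have h1 := (continuous_stateBound τ k).comp (continuous_const_add κ)
  have h2 := continuous_stateVariationBound τ κ k
  simp only [Function.comp_def] at h1
  simp only [errorLimitBound, inputBound]
  fun_prop

/-- At `s = 0` the recursion starts at zero and is linear in the variation, since `errorLimitBound`
is then a multiple of `V`. -/
theorem stateVariationBound_zero (τ c : ℝ) (k : ℕ) : stateVariationBound τ c 0 k = 0 := by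
  induction k with
  | zero => simp [stateVariationBound]
  | succ k ih => simp [stateVariationBound, errorLimitBound, ih]

/-! ### Estimates along the learning process -/

/-- The nominal quantities, the gain and the initial input are bounded by `κ` in the Euclidean
norms. -/
structure NominalBound {n m p : ℕ} (N : ℕ) (κ : ℝ) (P : ILCData n m p)
    (Ξ : ℕ → Matrix (Fin m) (Fin p) ℝ) (u₀ : ℕ → Fin m → ℝ) : Prop where
  A : ∀ k, k ≤ N → ‖P.A k‖ ≤ κ
  B : ∀ k, k ≤ N → ‖P.B k‖ ≤ κ
  C : ∀ k, k ≤ N → ‖P.C k‖ ≤ κ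
  D : ∀ k, k ≤ N → ‖P.D k‖ ≤ κ
  w : ∀ k, k ≤ N → euclNorm (P.w k) ≤ κ
  v : ∀ k, k ≤ N → euclNorm (P.v k) ≤ κ
  r : ∀ k, k ≤ N → euclNorm (P.r k) ≤ κ
  x₀ : euclNorm P.x₀ ≤ κ
  gain : ∀ k, k ≤ N → ‖Ξ k‖ ≤ κ
  input : ∀ k, k ≤ N → euclNorm (u₀ k) ≤ κ

/-- All uncertainties are bounded by `s` in the Euclidean norms. -/
structure UncertaintyBound {n m p : ℕ} (N : ℕ) (s : ℝ) (δ : ℕ → ILCData n m p) : Prop where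
  A : ∀ l k, k ≤ N → ‖(δ l).A k‖ ≤ s
  B : ∀ l k, k ≤ N → ‖(δ l).B k‖ ≤ s
  C : ∀ l k, k ≤ N → ‖(δ l).C k‖ ≤ s
  D : ∀ l k, k ≤ N → ‖(δ l).D k‖ ≤ s
  w : ∀ l k, k ≤ N → euclNorm ((δ l).w k) ≤ s
  v : ∀ l k, k ≤ N → euclNorm ((δ l).v k) ≤ s
  r : ∀ l k, k ≤ N → euclNorm ((δ l).r k) ≤ s
  x₀ : ∀ l, euclNorm ((δ l).x₀) ≤ s

namespace IsILCProcess

variable {n m p N : ℕ} {P : ILCData n m p} {δ : ℕ → ILCData n m p}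
  {Ξ : ℕ → Matrix (Fin m) (Fin p) ℝ} {u₀ : ℕ → Fin m → ℝ} {x : ℕ → ℕ → Fin n → ℝ}
  {u : ℕ → ℕ → Fin m → ℝ} {y e : ℕ → ℕ → Fin p → ℝ} {ρ κ s : ℝ}

/-- Working with the preimage `η` under the gain makes `I - D_l Ξ` act. The input itself would be
driven by `I - Ξ D_l`, which need not be a contraction, for instance when `m > p`. -/
theorem euclNorm_input_le
    (hproc : IsILCProcess N (fun l => P.perturb (δ l)) Ξ (fun _ => 0) x u y e)
    (hnom : NominalBound N κ P Ξ u₀) (hunc : UncertaintyBound N s δ)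
    (hu₀ : ∀ k, k ≤ N → u 0 k = u₀ k) (hρ0 : 0 ≤ ρ) (hρ1 : ρ < 1)
    (hcontr : ∀ l k, k ≤ N → ∀ z : Fin p → ℝ,
      euclNorm (z - (P.D k + (δ l).D k) *ᵥ (Ξ k *ᵥ z)) ≤ ρ * euclNorm z)
    {k : ℕ} (hk : k ≤ N) {X : ℝ} (hX : ∀ l, euclNorm (x l k) ≤ X) (l : ℕ) :
    euclNorm (u l k) ≤ inputBound (1 - ρ)⁻¹ (κ + s) X := by
  have hpos : 0 < 1 - ρ := sub_pos.mpr hρ1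
  have hs0 : 0 ≤ s := (euclNorm_nonneg _).trans (hunc.x₀ 0)
  have hκ0 : 0 ≤ κ := (euclNorm_nonneg _).trans hnom.x₀
  set c := κ + s with hc
  set q := c + c * X + c + c * c with hq
  have hX0 : 0 ≤ X := (euclNorm_nonneg _).trans (hX 0)
  have hc0 : 0 ≤ c := add_nonneg hκ0 hs0
  have hq0 : 0 ≤ q := by positivity
  -- `(1 - ρ)⁻¹ * q` is the fixed point of `t ↦ ρ t + q`, where `q` bounds `r_l - C_l x_l - v_l -
  -- D_l u_0`.
  have hη : ∀ l, ∃ η : Fin p → ℝ, u l k = u₀ k + Ξ k *ᵥ η ∧ euclNorm η ≤ (1 - ρ)⁻¹ * q := by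
    intro l
    induction l with
    | zero => exact ⟨0, by simp [hu₀ k hk], by rw [euclNorm_zero]; positivity⟩
    | succ l ih =>
      obtain ⟨η, hu, hη⟩ := ih
      refine ⟨η + e l k, ?_, ?_⟩
      · rw [hproc.update l k hk, hu, Matrix.zero_mulVec, Matrix.mulVec_add]
        abel
      · have hsplit : η + e l k = (η - (P.D k + (δ l).D k) *ᵥ (Ξ k *ᵥ η))
            + ((P.r k + (δ l).r k) - (P.C k + (δ l).C k) *ᵥ x l k - (P.v k + (δ l).v k)
              - (P.D k + (δ l).D k) *ᵥ u₀ k) := by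
          rw [hproc.error l k hk, hproc.output l k hk, hu]
          simp only [ILCData.perturb, Matrix.mulVec_add]
          abel
        have hfree : euclNorm ((P.r k + (δ l).r k) - (P.C k + (δ l).C k) *ᵥ x l k
            - (P.v k + (δ l).v k) - (P.D k + (δ l).D k) *ᵥ u₀ k) ≤ q := by
          refine (euclNorm_sub_le _ _).trans (add_le_add ((euclNorm_sub_le _ _).trans
            (add_le_add ((euclNorm_sub_le _ _).trans (add_le_add ?_ ?_)) ?_)) ?_)
          · exact (euclNorm_add_le _ _).trans (add_le_add (hnom.r k hk) (hunc.r l k hk))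
          · exact euclNorm_mulVec_le_of_le
              ((norm_add_le _ _).trans (add_le_add (hnom.C k hk) (hunc.C l k hk))) (hX l)
          · exact (euclNorm_add_le _ _).trans (add_le_add (hnom.v k hk) (hunc.v l k hk))
          · exact euclNorm_mulVec_le_of_le
              ((norm_add_le _ _).trans (add_le_add (hnom.D k hk) (hunc.D l k hk)))
              ((hnom.input k hk).trans (le_add_of_nonneg_right hs0))
        rw [hsplit]
        calc _ ≤ ρ * euclNorm η + q :=
              (euclNorm_add_le _ _).trans (add_le_add (hcontr l k hk η) hfree)
          _ ≤ ρ * ((1 - ρ)⁻¹ * q) + q := by gcongr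
          _ = (1 - ρ)⁻¹ * q := by field_simp; ring
  obtain ⟨η, hu, hη⟩ := hη l
  rw [hu]
  exact (euclNorm_add_le _ _).trans (add_le_add
    ((hnom.input k hk).trans (le_add_of_nonneg_right hs0))
    (euclNorm_mulVec_le_of_le ((hnom.gain k hk).trans (le_add_of_nonneg_right hs0)) hη))

/-- Induction on time, uniformly in the iteration: the input bound at time `k` needs only the state
bounds at that same time. -/
theorem euclNorm_state_le
    (hproc : IsILCProcess N (fun l => P.perturb (δ l)) Ξ (fun _ => 0) x u y e)
    (hnom : NominalBound N κ P Ξ u₀) (hunc : UncertaintyBound N s δ)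
    (hu₀ : ∀ k, k ≤ N → u 0 k = u₀ k) (hρ0 : 0 ≤ ρ) (hρ1 : ρ < 1)
    (hcontr : ∀ l k, k ≤ N → ∀ z : Fin p → ℝ,
      euclNorm (z - (P.D k + (δ l).D k) *ᵥ (Ξ k *ᵥ z)) ≤ ρ * euclNorm z)
    {k : ℕ} (hk : k ≤ N) (l : ℕ) : euclNorm (x l k) ≤ stateBound (1 - ρ)⁻¹ (κ + s) k := by
  induction k generalizing l with
  | zero =>
    rw [hproc.init l]
    exact (euclNorm_add_le _ _).trans (add_le_add hnom.x₀ (hunc.x₀ l))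
  | succ k ih =>
    have hk' : k ≤ N := (Nat.le_succ k).trans hk
    have hu := hproc.euclNorm_input_le hnom hunc hu₀ hρ0 hρ1 hcontr hk' (ih hk') l
    rw [hproc.state l k hk']
    refine (euclNorm_add_le _ _).trans (add_le_add ((euclNorm_add_le _ _).trans
      (add_le_add ?_ ?_)) ?_)
    · exact euclNorm_mulVec_le_of_le
        ((norm_add_le _ _).trans (add_le_add (hnom.A k hk') (hunc.A l k hk'))) (ih hk' l)
    · exact euclNorm_mulVec_le_of_le
        ((norm_add_le _ _).trans (add_le_add (hnom.B k hk') (hunc.B l k hk'))) hu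
    · exact (euclNorm_add_le _ _).trans (add_le_add (hnom.w k hk') (hunc.w l k hk'))

theorem euclNorm_output_le
    (hproc : IsILCProcess N (fun l => P.perturb (δ l)) Ξ (fun _ => 0) x u y e)
    (hnom : NominalBound N κ P Ξ u₀) (hunc : UncertaintyBound N s δ)
    {k : ℕ} (hk : k ≤ N) {X U : ℝ} {l : ℕ} (hX : euclNorm (x l k) ≤ X)
    (hU : euclNorm (u l k) ≤ U) :
    euclNorm (y l k) ≤ (κ + s) * X + (κ + s) * U + (κ + s) := by
  rw [hproc.output l k hk]
  refine (euclNorm_add_le _ _).trans (add_le_add ((euclNorm_add_le _ _).trans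
    (add_le_add ?_ ?_)) ?_)
  · exact euclNorm_mulVec_le_of_le
      ((norm_add_le _ _).trans (add_le_add (hnom.C k hk) (hunc.C l k hk))) hX
  · exact euclNorm_mulVec_le_of_le
      ((norm_add_le _ _).trans (add_le_add (hnom.D k hk) (hunc.D l k hk))) hU
  · exact (euclNorm_add_le _ _).trans (add_le_add (hnom.v k hk) (hunc.v l k hk))

theorem euclNorm_error_le
    (hproc : IsILCProcess N (fun l => P.perturb (δ l)) Ξ (fun _ => 0) x u y e)
    (hnom : NominalBound N κ P Ξ u₀) (hunc : UncertaintyBound N s δ)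
    {k : ℕ} (hk : k ≤ N) {Y : ℝ} {l : ℕ} (hY : euclNorm (y l k) ≤ Y) :
    euclNorm (e l k) ≤ (κ + s) + Y := by
  rw [hproc.error l k hk]
  exact (euclNorm_sub_le _ _).trans (add_le_add
    ((euclNorm_add_le _ _).trans (add_le_add (hnom.r k hk) (hunc.r l k hk))) hY)

/-- Subtracting consecutive iterations cancels the nominal reference, disturbance and feedthrough
terms. What remains as forcing is the state variation and terms of size `s`. -/
theorem asymptoticallyLE_error
    (hproc : IsILCProcess N (fun l => P.perturb (δ l)) Ξ (fun _ => 0) x u y e)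
    (hnom : NominalBound N κ P Ξ u₀) (hunc : UncertaintyBound N s δ)
    (hu₀ : ∀ k, k ≤ N → u 0 k = u₀ k) (hρ0 : 0 ≤ ρ) (hρ1 : ρ < 1)
    (hcontr : ∀ l k, k ≤ N → ∀ z : Fin p → ℝ,
      euclNorm (z - (P.D k + (δ l).D k) *ᵥ (Ξ k *ᵥ z)) ≤ ρ * euclNorm z)
    {k : ℕ} (hk : k ≤ N) {X V : ℝ} (hX : ∀ l, euclNorm (x l k) ≤ X)
    (hV : AsymptoticallyLE (fun l => euclNorm (x (l + 1) k - x l k)) V) :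
    AsymptoticallyLE (fun l => euclNorm (e l k)) (errorLimitBound (1 - ρ)⁻¹ (κ + s) s X V) := by
  have hs0 : 0 ≤ s := (euclNorm_nonneg _).trans (hunc.x₀ 0)
  have hκ0 : 0 ≤ κ := (euclNorm_nonneg _).trans hnom.x₀
  have hu := hproc.euclNorm_input_le hnom hunc hu₀ hρ0 hρ1 hcontr hk hX
  set U := inputBound (1 - ρ)⁻¹ (κ + s) X with hU
  have hg : AsymptoticallyLE (fun l => (κ + s) * euclNorm (x (l + 1) k - x l k)
      + (4 * s + 2 * (s * X) + 2 * (s * U)))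
      (4 * s + (κ + s) * V + 2 * (s * X) + 2 * (s * U)) := by
    convert (hV.const_mul (add_nonneg hκ0 hs0)).add
      (AsymptoticallyLE.of_le (f := fun _ => 4 * s + 2 * (s * X) + 2 * (s * U)) fun _ => le_rfl)
      using 1
    ring
  refine AsymptoticallyLE.of_contraction hρ0 hρ1 hg fun l => ?_
  have hsplit : e (l + 1) k = (e l k - (P.D k + (δ (l + 1)).D k) *ᵥ (Ξ k *ᵥ e l k))
      + ((δ (l + 1)).r k - (δ l).r k - ((δ (l + 1)).v k - (δ l).v k)
        - P.C k *ᵥ (x (l + 1) k - x l k)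
        - ((δ (l + 1)).C k *ᵥ x (l + 1) k - (δ l).C k *ᵥ x l k)
        - ((δ (l + 1)).D k *ᵥ u l k - (δ l).D k *ᵥ u l k)) := by
    rw [hproc.error (l + 1) k hk, hproc.output (l + 1) k hk, hproc.update l k hk]
    -- Freezing `Ξ e_l` lets the next rewrite expand only the free-standing error.
    generalize hz : Ξ k *ᵥ e l k = z
    rw [hproc.error l k hk, hproc.output l k hk]
    simp only [ILCData.perturb, Matrix.mulVec_add, Matrix.mulVec_sub, Matrix.add_mulVec,
      Matrix.zero_mulVec, Matrix.mulVec_zero]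
    abel
  rw [hsplit]
  refine (euclNorm_add_le _ _).trans (add_le_add (hcontr (l + 1) k hk _) ?_)
  have h1 := (euclNorm_sub_le ((δ (l + 1)).r k) ((δ l).r k)).trans
    (add_le_add (hunc.r (l + 1) k hk) (hunc.r l k hk))
  have h2 := (euclNorm_sub_le ((δ (l + 1)).v k) ((δ l).v k)).trans
    (add_le_add (hunc.v (l + 1) k hk) (hunc.v l k hk))
  have h3 := euclNorm_mulVec_le_of_le ((hnom.C k hk).trans (le_add_of_nonneg_right hs0))
    (le_refl (euclNorm (x (l + 1) k - x l k)))
  have h4 := (euclNorm_sub_le ((δ (l + 1)).C k *ᵥ x (l + 1) k) ((δ l).C k *ᵥ x l k)).trans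
    (add_le_add (euclNorm_mulVec_le_of_le (hunc.C (l + 1) k hk) (hX _))
      (euclNorm_mulVec_le_of_le (hunc.C l k hk) (hX _)))
  have h5 := (euclNorm_sub_le ((δ (l + 1)).D k *ᵥ u l k) ((δ l).D k *ᵥ u l k)).trans
    (add_le_add (euclNorm_mulVec_le_of_le (hunc.D (l + 1) k hk) (hu _))
      (euclNorm_mulVec_le_of_le (hunc.D l k hk) (hu _)))
  refine ((euclNorm_sub_le _ _).trans (add_le_add ((euclNorm_sub_le _ _).trans
    (add_le_add ((euclNorm_sub_le _ _).trans (add_le_add ((euclNorm_sub_le _ _).trans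
      (add_le_add h1 h2)) h3)) h4)) h5)).trans (le_of_eq ?_)
  ring

/-- Induction on time: variation at `k` bounds the error at `k`, and the error bounds the input
change `Ξ e_l`, hence the variation at `k + 1`. -/
theorem asymptoticallyLE_state_variation
    (hproc : IsILCProcess N (fun l => P.perturb (δ l)) Ξ (fun _ => 0) x u y e)
    (hnom : NominalBound N κ P Ξ u₀) (hunc : UncertaintyBound N s δ)
    (hu₀ : ∀ k, k ≤ N → u 0 k = u₀ k) (hρ0 : 0 ≤ ρ) (hρ1 : ρ < 1)
    (hcontr : ∀ l k, k ≤ N → ∀ z : Fin p → ℝ,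
      euclNorm (z - (P.D k + (δ l).D k) *ᵥ (Ξ k *ᵥ z)) ≤ ρ * euclNorm z)
    {k : ℕ} (hk : k ≤ N) :
    AsymptoticallyLE (fun l => euclNorm (x (l + 1) k - x l k))
      (stateVariationBound (1 - ρ)⁻¹ (κ + s) s k) := by
  have hs0 : 0 ≤ s := (euclNorm_nonneg _).trans (hunc.x₀ 0)
  have hκ0 : 0 ≤ κ := (euclNorm_nonneg _).trans hnom.x₀
  have hκc : κ ≤ κ + s := le_add_of_nonneg_right hs0
  have hc0 : 0 ≤ κ + s := add_nonneg hκ0 hs0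
  induction k with
  | zero =>
    refine AsymptoticallyLE.of_le fun l => ?_
    have hsplit : x (l + 1) 0 - x l 0 = (δ (l + 1)).x₀ - (δ l).x₀ := by
      rw [hproc.init, hproc.init]
      simp [ILCData.perturb]
    rw [hsplit, stateVariationBound, two_mul]
    exact (euclNorm_sub_le _ _).trans (add_le_add (hunc.x₀ _) (hunc.x₀ _))
  | succ k ih =>
    have hk' : k ≤ N := (Nat.le_succ k).trans hk
    have hV := ih hk'
    have hX := hproc.euclNorm_state_le hnom hunc hu₀ hρ0 hρ1 hcontr hk'
    have hU := hproc.euclNorm_input_le hnom hunc hu₀ hρ0 hρ1 hcontr hk' hX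
    have he := hproc.asymptoticallyLE_error hnom hunc hu₀ hρ0 hρ1 hcontr hk' hX hV
    rw [stateVariationBound]
    refine ((hV.const_mul hc0).add ((he.const_mul hc0).const_mul hc0) |>.add
      (AsymptoticallyLE.of_le (f := fun _ => _) fun _ => le_rfl)).mono fun l => ?_
    have hsplit : x (l + 1) (k + 1) - x l (k + 1) = P.A k *ᵥ (x (l + 1) k - x l k)
        + P.B k *ᵥ (Ξ k *ᵥ e l k)
        + (((δ (l + 1)).A k *ᵥ x (l + 1) k - (δ l).A k *ᵥ x l k)
          + ((δ (l + 1)).B k *ᵥ u (l + 1) k - (δ l).B k *ᵥ u l k)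
          + ((δ (l + 1)).w k - (δ l).w k)) := by
      have hΞ : Ξ k *ᵥ e l k = u (l + 1) k - u l k := by
        rw [hproc.update l k hk', Matrix.zero_mulVec]
        abel
      rw [hproc.state (l + 1) k hk', hproc.state l k hk', hΞ]
      simp only [ILCData.perturb, Matrix.mulVec_sub, Matrix.add_mulVec]
      abel
    rw [hsplit]
    have h1 := euclNorm_mulVec_le_of_le ((hnom.A k hk').trans hκc)
      (le_refl (euclNorm (x (l + 1) k - x l k)))
    have h2 := euclNorm_mulVec_le_of_le ((hnom.B k hk').trans hκc)
      (euclNorm_mulVec_le_of_le ((hnom.gain k hk').trans hκc) (le_refl (euclNorm (e l k))))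
    have h3 := (euclNorm_sub_le ((δ (l + 1)).A k *ᵥ x (l + 1) k) ((δ l).A k *ᵥ x l k)).trans
      (add_le_add (euclNorm_mulVec_le_of_le (hunc.A (l + 1) k hk') (hX _))
        (euclNorm_mulVec_le_of_le (hunc.A l k hk') (hX _)))
    have h4 := (euclNorm_sub_le ((δ (l + 1)).B k *ᵥ u (l + 1) k) ((δ l).B k *ᵥ u l k)).trans
      (add_le_add (euclNorm_mulVec_le_of_le (hunc.B (l + 1) k hk') (hU _))
        (euclNorm_mulVec_le_of_le (hunc.B l k hk') (hU _)))
    have h5 := (euclNorm_sub_le ((δ (l + 1)).w k) ((δ l).w k)).trans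
      (add_le_add (hunc.w (l + 1) k hk') (hunc.w l k hk'))
    rw [← two_mul] at h3 h4 h5
    exact (euclNorm_add_le _ _).trans (add_le_add ((euclNorm_add_le _ _).trans
      (add_le_add h1 h2)) ((euclNorm_add_le _ _).trans (add_le_add
        ((euclNorm_add_le _ _).trans (add_le_add h3 h4)) h5)))

end IsILCProcess

/-! ### Maxima over time and return to the given norms -/

section MaxOverTime

variable {N : ℕ} {f : ℕ → ℝ} {c : ℝ}

theorem le_maxOverTime {k : ℕ} (hk : k ≤ N) : f k ≤ maxOverTime N f :=
  Finset.le_sup' f (Finset.mem_range_succ_iff.mpr hk)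

theorem maxOverTime_le (h : ∀ k, k ≤ N → f k ≤ c) : maxOverTime N f ≤ c :=
  Finset.sup'_le _ _ fun k hk => h k (Finset.mem_range_succ_iff.mp hk)

theorem maxOverTime_lt (h : ∀ k, k ≤ N → f k < c) : maxOverTime N f < c :=
  (Finset.sup'_lt_iff _).mpr fun k hk => h k (Finset.mem_range_succ_iff.mp hk)

theorem continuous_maxOverTime {X : Type*} [TopologicalSpace X] {g : X → ℕ → ℝ}
    (hg : ∀ k, Continuous fun t => g t k) : Continuous fun t => maxOverTime N (g t) :=
  Continuous.finset_sup'_apply _ fun k _ => hg k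

theorem maxOverTime_vec_le (ν : MatrixNorms) {a : ℕ} {K : ℝ} (hK0 : 0 ≤ K)
    (hK : ∀ z : Fin a → ℝ, ν.vec z ≤ K * euclNorm z) {z : ℕ → Fin a → ℝ}
    (h : ∀ k, k ≤ N → euclNorm (z k) ≤ f k) :
    maxOverTime N (fun k => ν.vec (z k)) ≤ (K * maxOverTime N f).toNNReal :=
  maxOverTime_le fun k hk => (hK _).trans <|
    (mul_le_mul_of_nonneg_left ((h k hk).trans (le_maxOverTime hk)) hK0).trans
      (Real.le_coe_toNNReal _)

end MaxOverTime

theorem exists_nominalBound {n m p : ℕ} (N : ℕ) (P : ILCData n m p)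
    (Ξ : ℕ → Matrix (Fin m) (Fin p) ℝ) (u₀ : ℕ → Fin m → ℝ) :
    ∃ κ, NominalBound N κ P Ξ u₀ := by
  let f : ℕ → ℝ := fun k => ‖P.A k‖ + ‖P.B k‖ + ‖P.C k‖ + ‖P.D k‖ + euclNorm (P.w k)
    + euclNorm (P.v k) + euclNorm (P.r k) + euclNorm P.x₀ + ‖Ξ k‖ + euclNorm (u₀ k)
  have hf : ∀ {g : ℕ → ℝ}, (∀ k, g k ≤ f k) → ∀ k, k ≤ N → g k ≤ maxOverTime N f :=
    fun hg k hk => (hg k).trans (le_maxOverTime hk)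
  have hn : ∀ k, 0 ≤ ‖P.A k‖ ∧ 0 ≤ ‖P.B k‖ ∧ 0 ≤ ‖P.C k‖ ∧ 0 ≤ ‖P.D k‖ ∧ 0 ≤ euclNorm (P.w k)
      ∧ 0 ≤ euclNorm (P.v k) ∧ 0 ≤ euclNorm (P.r k) ∧ 0 ≤ euclNorm P.x₀ ∧ 0 ≤ ‖Ξ k‖
      ∧ 0 ≤ euclNorm (u₀ k) := fun k =>
    ⟨norm_nonneg _, norm_nonneg _, norm_nonneg _, norm_nonneg _, euclNorm_nonneg _,
      euclNorm_nonneg _, euclNorm_nonneg _, euclNorm_nonneg _, norm_nonneg _, euclNorm_nonneg _⟩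
  refine ⟨maxOverTime N f, ?_, ?_, ?_, ?_, ?_, ?_, ?_,
    hf (g := fun _ => euclNorm P.x₀) ?_ 0 (Nat.zero_le N), ?_, ?_⟩
  all_goals first | refine hf fun k => ?_ | intro k
  all_goals
    obtain ⟨h1, h2, h3, h4, h5, h6, h7, h8, h9, h10⟩ := hn k
    simp only [f]
    linarith

/-- The sum of the bounds for the eight classes of uncertainties. -/
def totalUncertainty (β : UncertaintyClass → ℝ≥0) : ℝ≥0 :=
  β .A + β .B + β .C + β .D + β .w + β .v + β .r + β .x₀

theorem le_totalUncertainty (β : UncertaintyClass → ℝ≥0) (i : UncertaintyClass) :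
    β i ≤ totalUncertainty β := by
  rw [← NNReal.coe_le_coe]
  simp only [totalUncertainty, NNReal.coe_add]
  cases i <;> linarith [(β .A).2, (β .B).2, (β .C).2, (β .D).2, (β .w).2, (β .v).2, (β .r).2,
    (β .x₀).2]

/-- Reduces the eight bounds to one Euclidean scalar that is linear in their sum, hence continuous
and zero at `β = 0`. -/
theorem MatrixNorms.exists_uncertaintyBound (ν : MatrixNorms) (n m p N : ℕ) :
    ∃ K : ℝ, ∀ (β : UncertaintyClass → ℝ≥0) (δ : ℕ → ILCData n m p),
      BoundedUncertainties N ν β δ → UncertaintyBound N (K * totalUncertainty β) δ := by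
  obtain ⟨cA, hA0, hA⟩ := ν.exists_l2_opNorm_le n n
  obtain ⟨cB, hB0, hB⟩ := ν.exists_l2_opNorm_le n m
  obtain ⟨cC, hC0, hC⟩ := ν.exists_l2_opNorm_le p n
  obtain ⟨cD, hD0, hD⟩ := ν.exists_l2_opNorm_le p m
  obtain ⟨cn, hn0, hn⟩ := ν.exists_euclNorm_le n
  obtain ⟨cp, hp0, hp⟩ := ν.exists_euclNorm_le p
  refine ⟨cA + cB + cC + cD + cn + cp, fun β δ h => ?_⟩
  have key : ∀ {c t t' : ℝ} (i : UncertaintyClass), c ≤ cA + cB + cC + cD + cn + cp → 0 < c →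
      t ≤ c * t' → t' ≤ β i → t ≤ (cA + cB + cC + cD + cn + cp) * totalUncertainty β := by
    intro c t t' i hc hc0 ht ht'
    calc t ≤ c * t' := ht
      _ ≤ c * totalUncertainty β := by
        gcongr
        exact ht'.trans (NNReal.coe_le_coe.mpr (le_totalUncertainty β i))
      _ ≤ _ := by gcongr
  exact
    { A := fun l k hk => key .A (by linarith) hA0 (hA _) (h.A l k hk)
      B := fun l k hk => key .B (by linarith) hB0 (hB _) (h.B l k hk)
      C := fun l k hk => key .C (by linarith) hC0 (hC _) (h.C l k hk)
      D := fun l k hk => key .D (by linarith) hD0 (hD _) (h.D l k hk)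
      w := fun l k hk => key .w (by linarith) hn0 (hn _) (h.w l k hk)
      v := fun l k hk => key .v (by linarith) hp0 (hp _) (h.v l k hk)
      r := fun l k hk => key .r (by linarith) hp0 (hp _) (h.r l k hk)
      x₀ := fun l => key .x₀ (by linarith) hn0 (hn _) (h.x₀ l) }

theorem MatrixNorms.exists_vec_le_three (ν : MatrixNorms) (n m p : ℕ) :
    ∃ K : ℝ, 0 ≤ K ∧ (∀ z : Fin n → ℝ, ν.vec z ≤ K * euclNorm z) ∧
      (∀ z : Fin m → ℝ, ν.vec z ≤ K * euclNorm z) ∧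
      (∀ z : Fin p → ℝ, ν.vec z ≤ K * euclNorm z) := by
  obtain ⟨cn, hn0, hn⟩ := ν.exists_vec_le n
  obtain ⟨cm, hm0, hm⟩ := ν.exists_vec_le m
  obtain ⟨cp, hp0, hp⟩ := ν.exists_vec_le p
  refine ⟨cn + cm + cp, by positivity, fun z => (hn z).trans ?_, fun z => (hm z).trans ?_,
    fun z => (hp z).trans ?_⟩
  all_goals exact mul_le_mul_of_nonneg_right (by linarith) (euclNorm_nonneg z)

theorem exists_uniform_contraction {m p a b : ℕ} (N : ℕ) (D : ℕ → Matrix (Fin p) (Fin m) ℝ)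
    (Ξ : ℕ → Matrix (Fin m) (Fin p) ℝ) (E : ℕ → Matrix (Fin p) (Fin a) ℝ)
    (F : ℕ → Matrix (Fin b) (Fin m) ℝ) {lam : ℝ} (hlam : 0 < lam)
    (hLMI : ∀ k, k ≤ N → NegDefinite (lmiMatrix (D k) (Ξ k) (E k) (F k) lam)) :
    ∃ ρ : ℝ, 0 ≤ ρ ∧ ρ < 1 ∧ ∀ k, k ≤ N → ∀ S : Matrix (Fin a) (Fin b) ℝ,
      (1 - Sᵀ * S).PosSemidef → ∀ z : Fin p → ℝ,
        euclNorm (z - (D k + E k * S * F k) *ᵥ (Ξ k *ᵥ z)) ≤ ρ * euclNorm z := by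
  have h : ∀ k, ∃ ρ : ℝ, k ≤ N → 0 ≤ ρ ∧ ρ < 1 ∧ ∀ S : Matrix (Fin a) (Fin b) ℝ,
      (1 - Sᵀ * S).PosSemidef → ∀ z : Fin p → ℝ,
        euclNorm (z - (D k + E k * S * F k) *ᵥ (Ξ k *ᵥ z)) ≤ ρ * euclNorm z := fun k => by
    by_cases hk : k ≤ N
    · obtain ⟨ρ, hρ⟩ := (hLMI k hk).exists_contraction hlam
      exact ⟨ρ, fun _ => hρ⟩
    -- A dummy value beyond the horizon; the maximum below does not see it.
    · exact ⟨0, fun hk' => absurd hk' hk⟩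
  choose ρ hρ using h
  refine ⟨maxOverTime N ρ, (hρ 0 (Nat.zero_le N)).1.trans (le_maxOverTime (Nat.zero_le N)),
    maxOverTime_lt fun k hk => (hρ k hk).2.1, fun k hk S hS z => ?_⟩
  exact ((hρ k hk).2.2 S hS z).trans
    (mul_le_mul_of_nonneg_right (le_maxOverTime hk) (euclNorm_nonneg z))

theorem limsup_maxOverTime_vec_le (ν : MatrixNorms) {N a : ℕ} {K : ℝ} (hK0 : 0 ≤ K)
    (hK : ∀ z : Fin a → ℝ, ν.vec z ≤ K * euclNorm z) {z : ℕ → ℕ → Fin a → ℝ} {f : ℕ → ℝ}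
    (h : ∀ k, k ≤ N → AsymptoticallyLE (fun l => euclNorm (z l k)) (f k)) :
    limsup (fun l => maxOverTime N (fun k => ν.vec (z l k))) atTop ≤
      (K * maxOverTime N f).toNNReal := by
  refine le_of_forall_pos_le_add fun η hη => limsup_le_of_le ?_ ?_
  -- A real `limsup` bound needs coboundedness, which nonnegativity of the norm supplies.
  · exact isCoboundedUnder_le_of_le atTop (x := 0) fun l =>
      (ν.vec_nonneg (z l 0)).trans
        (le_maxOverTime (f := fun k => ν.vec (z l k)) (Nat.zero_le N))
  · have hall : ∀ᶠ l in atTop, ∀ k ∈ Finset.range (N + 1), K * euclNorm (z l k) ≤ K * f k + η :=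
      (eventually_all_finset _).mpr fun k hk =>
        (h k (Finset.mem_range_succ_iff.mp hk)).const_mul hK0 η hη
    filter_upwards [hall] with l hl
    refine maxOverTime_le fun k hk => (hK _).trans
      ((hl k (Finset.mem_range_succ_iff.mpr hk)).trans (add_le_add_left ?_ η))
    exact (mul_le_mul_of_nonneg_left (le_maxOverTime hk) hK0).trans (Real.le_coe_toNNReal _)

end

/-! ### Assembly of the theorem -/

theorem theorem2 {n m p a b : ℕ} (N : ℕ) (ν : MatrixNorms)
    (P : ILCData n m p) (Ξ : ℕ → Matrix (Fin m) (Fin p) ℝ) (u₀ : ℕ → Fin m → ℝ)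
    (E : ℕ → Matrix (Fin p) (Fin a) ℝ) (F : ℕ → Matrix (Fin b) (Fin m) ℝ)
    (lam : ℝ) (hlam : 0 < lam)
    (hLMI : ∀ k, k ≤ N → NegDefinite (lmiMatrix (P.D k) (Ξ k) (E k) (F k) lam)) :
    ∃ ε : (UncertaintyClass → ℝ≥0) → ℝ≥0, Continuous ε ∧ ε 0 = 0 ∧
      ∀ β : UncertaintyClass → ℝ≥0, ∃ βx βu βy βe : ℝ≥0,
        ∀ (δ : ℕ → ILCData n m p) (x : ℕ → ℕ → Fin n → ℝ) (u : ℕ → ℕ → Fin m → ℝ)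
          (y e : ℕ → ℕ → Fin p → ℝ),
          BoundedUncertainties N ν β δ →
          StructuredFeedthrough N E F δ →
          IsILCProcess N (fun l => P.perturb (δ l)) Ξ (fun _ => 0) x u y e →
          (∀ k, k ≤ N → u 0 k = u₀ k) →
          (∀ l, maxOverTime N (fun k => ν.vec (x l k)) ≤ βx) ∧
          (∀ l, maxOverTime N (fun k => ν.vec (u l k)) ≤ βu) ∧
          (∀ l, maxOverTime N (fun k => ν.vec (y l k)) ≤ βy) ∧
          (∀ l, maxOverTime N (fun k => ν.vec (e l k)) ≤ βe) ∧
          limsup (fun l => maxOverTime N (fun k => ν.vec (e l k))) atTop ≤ ε β := by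
  obtain ⟨κ, hnom⟩ := exists_nominalBound N P Ξ u₀
  obtain ⟨K₁, hK₁⟩ := ν.exists_uncertaintyBound n m p N
  obtain ⟨K, hK0, hKx, hKu, hKy⟩ := ν.exists_vec_le_three n m p
  obtain ⟨ρ, hρ0, hρ1, hρ⟩ := exists_uniform_contraction N P.D Ξ E F hlam hLMI
  refine ⟨fun β => (K * maxOverTime N fun k =>
    errorLimitBound (1 - ρ)⁻¹ (κ + K₁ * totalUncertainty β) (K₁ * totalUncertainty β)
      (stateBound (1 - ρ)⁻¹ (κ + K₁ * totalUncertainty β) k)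
      (stateVariationBound (1 - ρ)⁻¹ (κ + K₁ * totalUncertainty β)
        (K₁ * totalUncertainty β) k)).toNNReal, ?_, ?_, fun β => ?_⟩
  · have hs : Continuous fun β : UncertaintyClass → ℝ≥0 => K₁ * (totalUncertainty β : ℝ) := by
      simp only [totalUncertainty]
      fun_prop
    exact continuous_real_toNNReal.comp (continuous_const.mul (continuous_maxOverTime fun k =>
      (continuous_errorLimitBound (1 - ρ)⁻¹ κ k).comp hs))
  · simp [totalUncertainty, errorLimitBound, stateVariationBound_zero, maxOverTime]
  · set s : ℝ := K₁ * totalUncertainty β with hs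
    set X : ℕ → ℝ := stateBound (1 - ρ)⁻¹ (κ + s) with hX
    set U : ℕ → ℝ := fun k => inputBound (1 - ρ)⁻¹ (κ + s) (X k) with hU
    set Y : ℕ → ℝ := fun k => (κ + s) * X k + (κ + s) * U k + (κ + s) with hY
    -- The witnesses use only the nominal data and `s`, so they are fixed before the uncertainties
    -- `δ` are introduced.
    refine ⟨(K * maxOverTime N X).toNNReal, (K * maxOverTime N U).toNNReal,
      (K * maxOverTime N Y).toNNReal, (K * maxOverTime N fun k => (κ + s) + Y k).toNNReal,
      fun δ x u y e hβ hδ hproc hu₀ => ?_⟩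
    have hunc := hK₁ β δ hβ
    obtain ⟨S, hS⟩ := hδ
    have hcontr : ∀ l k, k ≤ N → ∀ z : Fin p → ℝ,
        euclNorm (z - (P.D k + (δ l).D k) *ᵥ (Ξ k *ᵥ z)) ≤ ρ * euclNorm z := by
      intro l k hk z
      rw [(hS l k hk).1]
      exact hρ k hk _ (hS l k hk).2 z
    have hx : ∀ l k, k ≤ N → euclNorm (x l k) ≤ X k := fun l k hk =>
      hproc.euclNorm_state_le hnom hunc hu₀ hρ0 hρ1 hcontr hk l
    have hu : ∀ l k, k ≤ N → euclNorm (u l k) ≤ U k := fun l k hk =>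
      hproc.euclNorm_input_le hnom hunc hu₀ hρ0 hρ1 hcontr hk (fun l => hx l k hk) l
    have hy : ∀ l k, k ≤ N → euclNorm (y l k) ≤ Y k := fun l k hk =>
      hproc.euclNorm_output_le hnom hunc hk (hx l k hk) (hu l k hk)
    have he : ∀ l k, k ≤ N → euclNorm (e l k) ≤ (κ + s) + Y k := fun l k hk =>
      hproc.euclNorm_error_le hnom hunc hk (hy l k hk)
    exact ⟨fun l => maxOverTime_vec_le ν hK0 hKx (hx l),
      fun l => maxOverTime_vec_le ν hK0 hKu (hu l),
      fun l => maxOverTime_vec_le ν hK0 hKy (hy l),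
      fun l => maxOverTime_vec_le ν hK0 hKy (he l),
      limsup_maxOverTime_vec_le ν hK0 hKy fun k hk =>
        hproc.asymptoticallyLE_error hnom hunc hu₀ hρ0 hρ1 hcontr hk (fun l => hx l k hk)
          (hproc.asymptoticallyLE_state_variation hnom hunc hu₀ hρ0 hρ1 hcontr hk)⟩
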